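/- Theorem (Landau–Ingham Tauberian theorem). Let $f:[1,\infty)\to\mathbb{R}$ be non-negative and non-decreasing, and define $F(x)=\sum_{n\le x} f(x/n)$ for $x\ge 1$, the sum being over the integers $1\le n\le x$. Suppose that there are real constants $A,B,C$ such that $$F(x)=Ax\log x+Bx+C\frac{x}{\log x}+o\!\left(\frac{x}{\log x}\right)\qquad (x\to\infty).$$ Then $f(x)=Ax+o(x)$ as $x\to\infty$; in particular, if $A\neq 0$, then $f(x)\sim Ax$, i.e. $f(x)/(Ax)\to 1$ as $x\to\infty$. -/

import Mathlib

open Filter Asymptotics Topology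

/-- The transform `F(x) = ∑_{n ≤ x} f(x/n)`, the sum being over the integers `1 ≤ n ≤ x`.
For these `n` one has `x / n ≥ 1`, so only the values of `f` on `[1, ∞)` enter. -/
noncomputable def dilationSum (f : ℝ → ℝ) (x : ℝ) : ℝ :=
  ∑ n ∈ Finset.Icc 1 ⌊x⌋₊, f (x / (n : ℝ))

/-!
In logarithmic coordinates put `a(t) = e^{-t} f(e^t)`, extended by zero to `t < 0`; the claim is
`a(t) → A`. Keeping only the first two terms of the alternating sum
`F(x) - 2 F(x/2) = f(x) - f(x/2) + f(x/3) - ⋯` gives `f(x) = O(x)`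
(`exists_le_mul_of_dilationSum`), so `a` is bounded. A dilation by `n` is a shift by `log n`, hence
the Laplace transforms satisfy, for `Re s > 0`,
`ζ(1 + s) · L[a](s) = A / s² + B / s + L[e](s)`, where `e(t) = e^{-t} F(e^t) - A t - B → 0`
(`laplace_dilationSum`). As `ζ` has a simple pole at `1` and no zero on `Re s ≥ 1`, this becomes
`L[a](s) - A / s = R(s) + m(s) L[e](s)` with `R` and `m` analytic on the closed half-plane
`Re s ≥ 0` (`exists_analytic_sub_div_eq`).

Multiplying by a smooth compactly supported function `k` of `Im s` and by `e^{iux}`, and integrating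
along `Re s = σ`, turns products with Laplace transforms into convolutions. Two integrations by
parts show that the kernels arising from `k R` and `k m` decay quadratically, uniformly in
`σ ∈ (0, 1]` (`exists_norm_oscInt_le_inv_one_add_sq`). Letting `σ → 0`, the convolution of
`a - A · 1_{[0, ∞)}` with the Fourier transform of `k` is bounded by `O(x⁻²)` plus a convolution of
`|e|` with `1 / (1 + y²)`, so it tends to zero (`tendsto_integral_mul_oscInt`). No boundary values
of `L[e]` are needed.

Taking for `k` the convolution square of an even bump function makes the kernel non-negative
(`exists_nonneg_bandLimited_kernel`), and rescaling concentrates it near `0`. Since `f` is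
non-decreasing, `a(t + d) ≥ e^{-d} a(t)` for `d ≥ 0`, which lets one recover the limit of `a` from
those of its smoothings (`tendsto_of_tendsto_smoothings`).
-/

/-! ### The a priori bound -/

/-- The extension by zero to the whole line of a function on `[1, ∞)`. -/
noncomputable def extendByZero (f : ℝ → ℝ) (x : ℝ) : ℝ := if 1 ≤ x then f x else 0

lemma extendByZero_of_lt {f : ℝ → ℝ} {x : ℝ} (hx : x < 1) : extendByZero f x = 0 :=
  if_neg hx.not_ge

lemma extendByZero_of_le {f : ℝ → ℝ} {x : ℝ} (hx : 1 ≤ x) : extendByZero f x = f x :=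
  if_pos hx

lemma extendByZero_nonneg {f : ℝ → ℝ} (hf : ∀ x ∈ Set.Ici (1 : ℝ), 0 ≤ f x) (x : ℝ) :
    0 ≤ extendByZero f x := by
  unfold extendByZero
  split_ifs with h
  · exact hf x h
  · exact le_rfl

lemma monotone_extendByZero {f : ℝ → ℝ} (hf : ∀ x ∈ Set.Ici (1 : ℝ), 0 ≤ f x)
    (hmono : MonotoneOn f (Set.Ici (1 : ℝ))) : Monotone (extendByZero f) := by
  intro x y hxy
  by_cases hx : 1 ≤ x
  · rw [extendByZero_of_le hx, extendByZero_of_le (hx.trans hxy)]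
    exact hmono hx (hx.trans hxy) hxy
  · rw [extendByZero_of_lt (not_le.mp hx)]
    exact extendByZero_nonneg hf y

lemma dilationSum_extendByZero (f : ℝ → ℝ) (x : ℝ) :
    dilationSum (extendByZero f) x = dilationSum f x := by
  refine Finset.sum_congr rfl fun n hn => extendByZero_of_le ?_
  obtain ⟨h1, h2⟩ := Finset.mem_Icc.mp hn
  have hn0 : (0 : ℝ) < n := by exact_mod_cast h1
  rw [le_div_iff₀ hn0, one_mul]
  exact (Nat.le_floor_iff' (by omega)).mp h2

lemma eq_zero_of_natFloor_le {g : ℝ → ℝ} (hg : ∀ x < 1, g x = 0) {x : ℝ} {n : ℕ}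
    (hn : ⌊x⌋₊ ≤ n) : g (x / ((n : ℝ) + 1)) = 0 := by
  refine hg _ ?_
  rw [div_lt_one (by positivity)]
  exact (Nat.lt_floor_add_one x).trans_le (by gcongr)

lemma dilationSum_eq_sum_range {g : ℝ → ℝ} (hg : ∀ x < 1, g x = 0) {x : ℝ} {N : ℕ}
    (hN : ⌊x⌋₊ ≤ N) : dilationSum g x = ∑ n ∈ Finset.range N, g (x / ((n : ℝ) + 1)) := by
  have h1 : dilationSum g x = ∑ n ∈ Finset.range ⌊x⌋₊, g (x / ((n : ℝ) + 1)) := by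
    have h := Finset.sum_Ico_add' (fun n : ℕ => g (x / (n : ℝ))) 0 ⌊x⌋₊ 1
    push_cast at h
    rw [Finset.range_eq_Ico, h]
    exact Finset.sum_congr (by ext; simp) fun _ _ => rfl
  rw [h1]
  refine Finset.sum_subset (Finset.range_subset_range.mpr hN) fun n _ hn => ?_
  exact eq_zero_of_natFloor_le hg (by simpa using hn)

/-- Discarding all but the first two terms of the alternating sum
`F(x) - 2 F(x/2) = g(x) - g(x/2) + g(x/3) - ⋯`, whose terms decrease in size. -/
lemma sub_half_le_dilationSum {g : ℝ → ℝ} (hg : ∀ x < 1, g x = 0) (hmono : Monotone g)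
    {x : ℝ} (hx : 1 ≤ x) :
    g x - g (x / 2) ≤ dilationSum g x - 2 * dilationSum g (x / 2) := by
  set N := ⌊x⌋₊ with hN
  have hNpos : 0 < N := Nat.floor_pos.mpr hx
  have h1 := dilationSum_eq_sum_range hg (x := x) (N := 2 * N) (by omega)
  have h2 := dilationSum_eq_sum_range hg (x := x / 2) (N := N)
    (Nat.floor_mono (by linarith))
  have h3 : ∀ M : ℕ, ∑ n ∈ Finset.range (2 * M), g (x / ((n : ℝ) + 1)) =
      ∑ n ∈ Finset.range M, (g (x / (2 * n + 1)) + g (x / (2 * n + 2))) := by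
    intro M
    induction M with
    | zero => simp
    | succ M ih =>
      rw [show 2 * (M + 1) = 2 * M + 1 + 1 by ring, Finset.sum_range_succ,
        Finset.sum_range_succ, ih, Finset.sum_range_succ]
      push_cast
      ring_nf
  rw [h1, h2, h3, Finset.mul_sum, ← Finset.sum_sub_distrib]
  have h4 : ∀ n : ℕ, x / 2 / ((n : ℝ) + 1) = x / (2 * n + 2) := fun n => by
    rw [div_div]; ring_nf
  simp only [h4]
  have h5 : g x - g (x / 2) = g (x / (2 * (0 : ℕ) + 1)) + g (x / (2 * (0 : ℕ) + 2)) -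
      2 * g (x / (2 * (0 : ℕ) + 2)) := by
    simp; ring
  rw [h5]
  refine Finset.single_le_sum (f := fun n : ℕ => g (x / (2 * (n : ℝ) + 1)) +
    g (x / (2 * n + 2)) - 2 * g (x / (2 * n + 2))) (fun n _ => ?_) (Finset.mem_range.mpr hNpos)
  have : g (x / (2 * n + 2)) ≤ g (x / (2 * n + 1)) := hmono (by gcongr; norm_num)
  linarith

/-- A bound `g x ≤ g (x / 2) + c * x` for large `x` sums to a linear bound along the halvings
of `x`. -/
lemma exists_le_mul_of_le_half_add {g : ℝ → ℝ} (hmono : Monotone g) (h0 : ∀ x, 0 ≤ g x)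
    {c x₀ : ℝ} (hc : 0 ≤ c) (hx₀ : 1 ≤ x₀) (h : ∀ x ≥ x₀, g x ≤ g (x / 2) + c * x) :
    ∃ M, 0 ≤ M ∧ ∀ x ≥ 1, g x ≤ M * x := by
  have key : ∀ n : ℕ, ∀ x, 0 ≤ x → x ≤ 2 ^ n * x₀ → g x ≤ g x₀ + 2 * c * x := by
    intro n
    induction n with
    | zero =>
      intro x hx hxn
      have : g x ≤ g x₀ := hmono (by simpa using hxn)
      nlinarith [mul_nonneg hc hx]
    | succ n ih =>
      intro x hx hxn
      rcases le_total x x₀ with h1 | h1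
      · have := hmono h1
        nlinarith [mul_nonneg hc hx]
      · have h2 := ih (x / 2) (by linarith) (by rw [pow_succ] at hxn; linarith)
        have h3 := h x h1
        linarith
  refine ⟨g x₀ + 2 * c, by linarith [h0 x₀], fun x hx => ?_⟩
  obtain ⟨n, hn⟩ := pow_unbounded_of_one_lt x (one_lt_two (α := ℝ))
  have h1 := key n x (by linarith) (by nlinarith [pow_pos (two_pos (α := ℝ)) n])
  nlinarith [h0 x₀]

/-- The bound `f(x) = O(x)`. -/
lemma exists_le_mul_of_dilationSum {g : ℝ → ℝ} (hg : ∀ x < 1, g x = 0) (hmono : Monotone g)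
    (h0 : ∀ x, 0 ≤ g x) {A B : ℝ}
    (hF : (fun x : ℝ => dilationSum g x - (A * x * Real.log x + B * x)) =o[atTop]
      (fun x : ℝ => x)) :
    ∃ M, 0 ≤ M ∧ ∀ x ≥ 1, g x ≤ M * x := by
  have h1 : ∀ᶠ x : ℝ in atTop, |dilationSum g x - (A * x * Real.log x + B * x)| ≤ x := by
    filter_upwards [hF.bound one_pos, eventually_ge_atTop 0] with x hx hx0
    simpa [abs_of_nonneg hx0] using hx
  obtain ⟨x₁, hx₁⟩ := eventually_atTop.mp h1
  have hlog : 0 ≤ Real.log 2 := Real.log_nonneg one_le_two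
  refine exists_le_mul_of_le_half_add hmono h0 (c := |A| * Real.log 2 + 2)
    (x₀ := max (2 * x₁) 1) (by positivity) (le_max_right _ _) fun x hx => ?_
  have hx1 : 1 ≤ x := (le_max_right _ _).trans hx
  have hx2 : x₁ ≤ x / 2 := by linarith [(le_max_left (2 * x₁) 1).trans hx]
  have e1 := abs_le.mp (hx₁ x (by linarith))
  have e2 := abs_le.mp (hx₁ (x / 2) hx2)
  rw [Real.log_div (by linarith) two_ne_zero] at e2
  have e3 := sub_half_le_dilationSum hg hmono hx1
  have e4 : A * (x * Real.log 2) ≤ |A| * (x * Real.log 2) :=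
    mul_le_mul_of_nonneg_right (le_abs_self A) (by positivity)
  linarith [e1.2, e2.1]

open MeasureTheory Complex
open scoped ContDiff

/-! ### Oscillatory integrals along vertical lines -/

/-- The oscillatory integral `∫ k(u) m(σ + iu) e^{iuy} du` along the line `Re s = σ`. -/
noncomputable def oscInt (k : ℝ → ℂ) (m : ℂ → ℂ) (σ y : ℝ) : ℂ :=
  ∫ u : ℝ, k u * m (σ + u * I) * cexp (u * y * I)

/-- The closed right half-plane. -/
abbrev rightHalfPlane : Set ℂ := {s | 0 ≤ s.re}

lemma norm_cexp_mul_mul_I (u y : ℝ) : ‖cexp (u * y * I)‖ = 1 := by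
  rw [← ofReal_mul]; exact norm_exp_ofReal_mul_I _

lemma continuous_comp_line {m : ℂ → ℂ} (hm : ContinuousOn m rightHalfPlane) {σ : ℝ}
    (hσ : 0 ≤ σ) : Continuous fun u : ℝ => m (σ + u * I) :=
  hm.comp_continuous (by fun_prop) fun u => by simpa using hσ

lemma integrable_mul_comp_line {k : ℝ → ℂ} {m : ℂ → ℂ} (hk : Continuous k)
    (hks : HasCompactSupport k) (hm : ContinuousOn m rightHalfPlane) {σ : ℝ} (hσ : 0 ≤ σ) :
    Integrable fun u : ℝ => k u * m (σ + u * I) :=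
  (hk.mul (continuous_comp_line hm hσ)).integrable_of_hasCompactSupport hks.mul_right

lemma integrable_oscInt {k : ℝ → ℂ} {m : ℂ → ℂ} (hk : Continuous k)
    (hks : HasCompactSupport k) (hm : ContinuousOn m rightHalfPlane) {σ : ℝ} (hσ : 0 ≤ σ)
    (y : ℝ) : Integrable fun u : ℝ => k u * m (σ + u * I) * cexp (u * y * I) :=
  ((hk.mul (continuous_comp_line hm hσ)).mul (by fun_prop)).integrable_of_hasCompactSupport
    hks.mul_right.mul_right

lemma exists_norm_oscInt_le {k : ℝ → ℂ} {m : ℂ → ℂ} (hk : Continuous k)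
    (hks : HasCompactSupport k) (hm : ContinuousOn m rightHalfPlane) :
    ∃ C, 0 ≤ C ∧ ∀ σ ∈ Set.Icc (0 : ℝ) 1, ∀ y, ‖oscInt k m σ y‖ ≤ C := by
  have hcomp : IsCompact (Set.Icc (0 : ℝ) 1 ×ˢ tsupport k) := isCompact_Icc.prod hks
  have hcont : ContinuousOn (fun p : ℝ × ℝ => m (p.1 + p.2 * I))
      (Set.Icc (0 : ℝ) 1 ×ˢ tsupport k) :=
    hm.comp (by fun_prop) fun p hp => by simpa using hp.1.1
  obtain ⟨D, hD⟩ := hcomp.exists_bound_of_continuousOn hcont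
  have hint : Integrable fun u => ‖k u‖ := (hk.integrable_of_hasCompactSupport hks).norm
  refine ⟨|D| * ∫ u, ‖k u‖, by positivity, fun σ hσ y => ?_⟩
  rw [← integral_const_mul]
  refine norm_integral_le_of_norm_le (hint.const_mul _) (ae_of_all _ fun u => ?_)
  rw [norm_mul, norm_mul, norm_cexp_mul_mul_I, mul_one, mul_comm]
  by_cases hu : u ∈ tsupport k
  · exact mul_le_mul_of_nonneg_right ((hD (σ, u) ⟨hσ, hu⟩).trans (le_abs_self D))
      (norm_nonneg _)
  · simp [image_eq_zero_of_notMem_tsupport hu]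

/-- Integration by parts. -/
lemma mul_oscInt {k : ℝ → ℂ} {m : ℂ → ℂ} (hk : ContDiff ℝ ∞ k) (hks : HasCompactSupport k)
    (hm : AnalyticOnNhd ℂ m rightHalfPlane) {σ : ℝ} (hσ : 0 ≤ σ) (y : ℝ) :
    (y * I) * oscInt k m σ y = -(oscInt (deriv k) m σ y + I * oscInt k (deriv m) σ y) := by
  have hk' : ContDiff ℝ ∞ (deriv k) := (contDiff_infty_iff_deriv.mp hk).2
  have i1 := integrable_oscInt hk'.continuous hks.deriv hm.continuousOn hσ y
  have i2 := (integrable_oscInt hk.continuous hks hm.deriv.continuousOn hσ y).const_mul I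
  have i0 := integrable_oscInt hk.continuous hks hm.continuousOn hσ y
  have i3 := i0.const_mul (y * I)
  have hder : ∀ u : ℝ, HasDerivAt (fun u : ℝ => k u * m (σ + u * I) * cexp (u * y * I))
      (deriv k u * m (σ + u * I) * cexp (u * y * I) +
        I * (k u * deriv m (σ + u * I) * cexp (u * y * I)) +
        (y * I) * (k u * m (σ + u * I) * cexp (u * y * I))) u := by
    intro u
    have d1 : HasDerivAt k (deriv k u) u :=
      (hk.differentiable (by simp)).differentiableAt.hasDerivAt
    have d2 : HasDerivAt (fun u : ℝ => (σ : ℂ) + u * I) I u := by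
      simpa using ((hasDerivAt_id u).ofReal_comp.mul_const I).const_add (σ : ℂ)
    have d3 : HasDerivAt m (deriv m (σ + u * I)) (σ + u * I) :=
      (hm _ (by simpa using hσ)).differentiableAt.hasDerivAt
    have d4 : HasDerivAt (fun u : ℝ => (u : ℂ) * y * I) (y * I) u := by
      simpa [mul_assoc] using (hasDerivAt_id u).ofReal_comp.mul_const ((y : ℂ) * I)
    exact ((d1.mul (d3.comp u d2)).mul d4.cexp).congr_deriv (by
      simp only [Pi.mul_apply, Function.comp]
      ring)
  have h := integral_eq_zero_of_hasDerivAt_of_integrable hder ((i1.add i2).add i3) i0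
  have i12 : Integrable fun u : ℝ => deriv k u * m (σ + u * I) * cexp (u * y * I) +
      I * (k u * deriv m (σ + u * I) * cexp (u * y * I)) := i1.add i2
  rw [integral_add i12 i3, integral_add i1 i2, integral_const_mul,
    integral_const_mul] at h
  unfold oscInt
  linear_combination h

/-- Two integrations by parts give quadratic decay, uniformly up to the line `Re s = 0`. -/
lemma exists_norm_oscInt_le_inv_one_add_sq {k : ℝ → ℂ} {m : ℂ → ℂ} (hk : ContDiff ℝ ∞ k)
    (hks : HasCompactSupport k) (hm : AnalyticOnNhd ℂ m rightHalfPlane) :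
    ∃ C, 0 ≤ C ∧ ∀ σ ∈ Set.Icc (0 : ℝ) 1, ∀ y, ‖oscInt k m σ y‖ ≤ C * (1 + y ^ 2)⁻¹ := by
  have hk1 : ContDiff ℝ ∞ (deriv k) := (contDiff_infty_iff_deriv.mp hk).2
  have hk2 : ContDiff ℝ ∞ (deriv (deriv k)) := (contDiff_infty_iff_deriv.mp hk1).2
  obtain ⟨C0, h0, H0⟩ := exists_norm_oscInt_le hk.continuous hks hm.continuousOn
  obtain ⟨C1, h1, H1⟩ := exists_norm_oscInt_le hk2.continuous hks.deriv.deriv hm.continuousOn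
  obtain ⟨C2, h2, H2⟩ := exists_norm_oscInt_le hk1.continuous hks.deriv hm.deriv.continuousOn
  obtain ⟨C3, h3, H3⟩ := exists_norm_oscInt_le hk.continuous hks hm.deriv.deriv.continuousOn
  refine ⟨C0 + (C1 + 2 * C2 + C3), by positivity, fun σ hσ y => ?_⟩
  rw [← div_eq_mul_inv, le_div_iff₀ (by positivity)]
  have e : (y : ℂ) ^ 2 * oscInt k m σ y = -(oscInt (deriv (deriv k)) m σ y +
      2 * I * oscInt (deriv k) (deriv m) σ y - oscInt k (deriv (deriv m)) σ y) := by
    have e1 := mul_oscInt hk hks hm hσ.1 y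
    have e2 := mul_oscInt hk1 hks.deriv hm hσ.1 y
    have e3 := mul_oscInt hk hks hm.deriv hσ.1 y
    linear_combination (-(y * I)) * e1 + e2 + I * e3 +
      ((y : ℂ) ^ 2 * oscInt k m σ y - oscInt k (deriv (deriv m)) σ y) * I_sq
  have e' : y ^ 2 * ‖oscInt k m σ y‖ ≤ C1 + 2 * C2 + C3 := by
    have : ‖(y : ℂ) ^ 2 * oscInt k m σ y‖ = y ^ 2 * ‖oscInt k m σ y‖ := by simp
    rw [← this, e, norm_neg]
    refine (norm_sub_le _ _).trans (add_le_add ((norm_add_le _ _).trans ?_) (H3 σ hσ y))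
    have : ‖2 * I * oscInt (deriv k) (deriv m) σ y‖ = 2 * ‖oscInt (deriv k) (deriv m) σ y‖ := by
      simp
    rw [this]
    linarith [H1 σ hσ y, H2 σ hσ y]
  linarith [H0 σ hσ y]

/-! ### Laplace transforms -/

/-- The (two-sided) Laplace transform `∫ c(t) e^{-st} dt`, used for functions `c` that vanish on
the negative half-line. -/
noncomputable def laplace (c : ℝ → ℝ) (s : ℂ) : ℂ :=
  ∫ t : ℝ, (c t : ℂ) * cexp (-(s * t))

lemma norm_mul_cexp_neg (r : ℝ) (s : ℂ) (t : ℝ) :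
    ‖(r : ℂ) * cexp (-(s * t))‖ = |r| * Real.exp (-(s.re * t)) := by
  rw [norm_mul, norm_real, Real.norm_eq_abs, norm_exp]
  simp

lemma integrable_mul_cexp_neg {c : ℝ → ℝ} (hc : Measurable c) (h0 : ∀ t < 0, c t = 0) {M : ℝ}
    (hM : ∀ t, |c t| ≤ M * (1 + |t|)) {s : ℂ} (hs : 0 < s.re) :
    Integrable fun t : ℝ => (c t : ℂ) * cexp (-(s * t)) := by
  have hM0 : 0 ≤ M := by simpa using (abs_nonneg _).trans (hM 0)
  set σ := s.re with hσ
  have hdom : Integrable (Set.indicator (Set.Ici 0)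
      fun t : ℝ => M * (1 + 2 / σ) * Real.exp ((-(σ / 2)) * t)) := by
    rw [integrable_indicator_iff measurableSet_Ici, integrableOn_Ici_iff_integrableOn_Ioi]
    exact (exp_neg_integrableOn_Ioi 0 (half_pos hs)).const_mul _
  refine hdom.mono' ?_ (ae_of_all _ fun t => ?_)
  · exact (Measurable.mul (by fun_prop) (by fun_prop)).aestronglyMeasurable
  rw [norm_mul_cexp_neg, ← hσ]
  by_cases ht : 0 ≤ t
  · rw [Set.indicator_of_mem (by exact ht)]
    have h1 : 1 + |t| ≤ (1 + 2 / σ) * Real.exp (σ / 2 * t) := by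
      have e1 : σ / 2 * t + 1 ≤ Real.exp (σ / 2 * t) := Real.add_one_le_exp _
      have e2 : t = 2 / σ * (σ / 2 * t) := by field_simp
      have e3 : 0 ≤ σ / 2 * t := by positivity
      have e4 : 0 ≤ 2 / σ := by positivity
      rw [abs_of_nonneg ht]
      calc 1 + t = 1 + 2 / σ * (σ / 2 * t) := by rw [← e2]
        _ ≤ (1 + 2 / σ) * (σ / 2 * t + 1) := by nlinarith
        _ ≤ _ := by gcongr
    calc |c t| * Real.exp (-(σ * t)) ≤ M * (1 + |t|) * Real.exp (-(σ * t)) := by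
          gcongr; exact hM t
      _ ≤ M * ((1 + 2 / σ) * Real.exp (σ / 2 * t)) * Real.exp (-(σ * t)) := by gcongr
      _ = M * (1 + 2 / σ) * (Real.exp (σ / 2 * t) * Real.exp (-(σ * t))) := by ring
      _ = _ := by rw [← Real.exp_add]; congr 2; ring
  · rw [Set.indicator_of_notMem (by exact ht), h0 t (not_le.mp ht)]
    simp

lemma laplace_add_mul {c d : ℝ → ℝ} {s : ℂ}
    (hc : Integrable fun t : ℝ => (c t : ℂ) * cexp (-(s * t)))
    (hd : Integrable fun t : ℝ => (d t : ℂ) * cexp (-(s * t))) (r : ℝ) :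
    laplace (fun t => c t + r * d t) s = laplace c s + r * laplace d s := by
  unfold laplace
  rw [← integral_const_mul, ← integral_add hc (hd.const_mul _)]
  congr 1 with t
  push_cast
  ring

/-- The function `t ↦ P + Q t` on `[0, ∞)`, extended by zero. -/
noncomputable def linearRamp (P Q t : ℝ) : ℝ := if 0 ≤ t then P + Q * t else 0

lemma linearRamp_of_lt (P Q : ℝ) {t : ℝ} (ht : t < 0) : linearRamp P Q t = 0 := if_neg ht.not_ge

lemma linearRamp_of_le (P Q : ℝ) {t : ℝ} (ht : 0 ≤ t) : linearRamp P Q t = P + Q * t := if_pos ht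

lemma measurable_linearRamp (P Q : ℝ) : Measurable (linearRamp P Q) :=
  Measurable.ite measurableSet_Ici (by fun_prop) measurable_const

lemma abs_linearRamp_le (P Q t : ℝ) : |linearRamp P Q t| ≤ (|P| + |Q|) * (1 + |t|) := by
  rcases lt_or_ge t 0 with ht | ht
  · rw [linearRamp_of_lt _ _ ht, abs_zero]; positivity
  · rw [linearRamp_of_le _ _ ht]
    refine (abs_add_le _ _).trans ?_
    rw [abs_mul]
    nlinarith [abs_nonneg P, abs_nonneg Q, abs_nonneg t, mul_nonneg (abs_nonneg P) (abs_nonneg t)]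

lemma integrable_linearRamp (P Q : ℝ) {s : ℂ} (hs : 0 < s.re) :
    Integrable fun t : ℝ => (linearRamp P Q t : ℂ) * cexp (-(s * t)) :=
  integrable_mul_cexp_neg (measurable_linearRamp P Q) (fun _ => linearRamp_of_lt P Q)
    (abs_linearRamp_le P Q) hs

lemma laplace_linearRamp (P Q : ℝ) {s : ℂ} (hs : 0 < s.re) :
    laplace (linearRamp P Q) s = P / s + Q / s ^ 2 := by
  have hs0 : s ≠ 0 := fun h => by simp [h] at hs
  have hset : ∀ P Q : ℝ, (fun t : ℝ => (linearRamp P Q t : ℂ) * cexp (-(s * t))) =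
      Set.indicator (Set.Ici 0) fun t : ℝ => ((P : ℂ) + Q * t) * cexp (-(s * t)) := by
    intro P Q
    ext t
    by_cases ht : 0 ≤ t
    · rw [Set.indicator_of_mem (by exact ht), linearRamp_of_le _ _ ht]; push_cast; rfl
    · rw [Set.indicator_of_notMem (by exact ht), linearRamp_of_lt _ _ (not_le.mp ht)]; simp
  have hint : ∀ P Q : ℝ, IntegrableOn (fun t : ℝ => ((P : ℂ) + Q * t) * cexp (-(s * t)))
      (Set.Ioi 0) := by
    intro P Q
    have h := integrable_linearRamp P Q hs
    rwa [hset, integrable_indicator_iff measurableSet_Ici,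
      integrableOn_Ici_iff_integrableOn_Ioi] at h
  have hder : ∀ t : ℝ, HasDerivAt
      (fun t : ℝ => -((P / s + Q / s ^ 2) * (((1 : ℝ) : ℂ) + (0 : ℝ) * t) * cexp (-(s * t)) +
        Q / s * (((0 : ℝ) : ℂ) + (1 : ℝ) * t) * cexp (-(s * t))))
      (((P : ℂ) + Q * t) * cexp (-(s * t))) t := by
    intro t
    have d1 : HasDerivAt (fun t : ℝ => (t : ℂ)) 1 t := (hasDerivAt_id t).ofReal_comp
    have d2 : HasDerivAt (fun t : ℝ => cexp (-(s * t))) (cexp (-(s * t)) * (-(s * 1))) t :=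
      (d1.const_mul s).neg.cexp
    have d3 := ((((d1.const_mul ((0 : ℝ) : ℂ)).const_add ((1 : ℝ) : ℂ)).const_mul
      (P / s + Q / s ^ 2)).mul d2).add
      ((((d1.const_mul ((1 : ℝ) : ℂ)).const_add ((0 : ℝ) : ℂ)).const_mul (Q / s)).mul d2)
    refine d3.neg.congr_deriv ?_
    push_cast
    field_simp
    ring
  have hlim := tendsto_zero_of_hasDerivAt_of_integrableOn_Ioi (fun t _ => hder t) (hint P Q)
    (by
      have := (((hint 1 0).const_mul (P / s + Q / s ^ 2)).add
        ((hint 0 1).const_mul (Q / s))).neg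
      refine IntegrableOn.congr_fun this (fun t _ => ?_) measurableSet_Ioi
      simp only [Pi.neg_apply, Pi.add_apply]
      ring)
  rw [laplace, hset, integral_indicator measurableSet_Ici, integral_Ici_eq_integral_Ioi,
    integral_Ioi_of_hasDerivAt_of_tendsto' (fun t _ => hder t) (hint P Q) hlim]
  simp

/-- Dilating by `n` becomes a shift by `log n`, so that the sum over dilations multiplies the
Laplace transform by `∑ n⁻¹⁻ˢ`. -/
lemma laplace_dilationSum {g : ℝ → ℝ} (hg : ∀ x < 1, g x = 0) {M : ℝ}
    (hmeas : Measurable g) (hM : ∀ t, |Real.exp (-t) * g (Real.exp t)| ≤ M)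
    {s : ℂ} (hs : 0 < s.re) :
    laplace (fun t => Real.exp (-t) * dilationSum g (Real.exp t)) s =
      riemannZeta (1 + s) * laplace (fun t => Real.exp (-t) * g (Real.exp t)) s := by
  set a : ℝ → ℝ := fun t => Real.exp (-t) * g (Real.exp t) with ha
  have hM0 : 0 ≤ M := (abs_nonneg _).trans (hM 0)
  have hint : ∀ s : ℂ, 0 < s.re → Integrable fun t : ℝ => (a t : ℂ) * cexp (-(s * t)) := by
    refine fun s hs => integrable_mul_cexp_neg (M := M) (by fun_prop) (fun t ht => ?_)
      (fun t => ?_) hs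
    · have : Real.exp t < 1 := by simpa using Real.exp_lt_exp.mpr ht
      simp [ha, hg _ this]
    · nlinarith [hM t, abs_nonneg t]
  have hterm : ∀ (n : ℕ) (t : ℝ),
      ((Real.exp (-t) * g (Real.exp t / ((n : ℝ) + 1)) : ℝ) : ℂ) * cexp (-(s * t)) =
      1 / ((n : ℂ) + 1) ^ (1 + s) *
        ((a (t - Real.log (n + 1)) : ℂ) * cexp (-(s * ((t - Real.log (n + 1) : ℝ) : ℂ)))) := by
    intro n t
    have hn : (0 : ℝ) < n + 1 := by positivity
    have hnc : (n : ℂ) + 1 ≠ 0 := by exact_mod_cast hn.ne'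
    have e1 : a (t - Real.log (n + 1)) =
        (n + 1) * (Real.exp (-t) * g (Real.exp t / ((n : ℝ) + 1))) := by
      simp only [ha]
      rw [neg_sub, Real.exp_sub, Real.exp_sub, Real.exp_log hn, Real.exp_neg]
      ring
    have e2 : ((n : ℂ) + 1) ^ (1 + s) = (n + 1) * cexp (s * Real.log (n + 1)) := by
      rw [cpow_add _ _ hnc, cpow_one, cpow_def_of_ne_zero hnc]
      have : Complex.log ((n : ℂ) + 1) = (Real.log (n + 1) : ℝ) := by
        rw [ofReal_log hn.le]; push_cast; rfl
      rw [this, mul_comm s]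
    have e3 : cexp (-(s * ((t - Real.log (n + 1) : ℝ) : ℂ))) =
        cexp (-(s * t)) * cexp (s * Real.log (n + 1)) := by
      rw [← Complex.exp_add]; push_cast; ring_nf
    rw [e1, e2, e3]
    push_cast
    field_simp [Complex.exp_ne_zero]
  have hshift : ∀ n : ℕ, Integrable fun t : ℝ => 1 / ((n : ℂ) + 1) ^ (1 + s) *
        ((a (t - Real.log (n + 1)) : ℂ) * cexp (-(s * ((t - Real.log (n + 1) : ℝ) : ℂ)))) :=
    fun n => ((hint s hs).comp_sub_right (Real.log (n + 1))).const_mul _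
  have hsum := hasSum_integral_of_summable_integral_norm
    (F := fun (n : ℕ) (t : ℝ) => 1 / ((n : ℂ) + 1) ^ (1 + s) *
        ((a (t - Real.log (n + 1)) : ℂ) * cexp (-(s * ((t - Real.log (n + 1) : ℝ) : ℂ)))))
    hshift (by
      have hz : Summable fun n : ℕ => ‖1 / ((n : ℂ) + 1) ^ (1 + s)‖ := by
        have := (summable_nat_add_iff 1).mpr
          (Complex.summable_one_div_nat_cpow.mpr (show 1 < (1 + s).re by simpa using hs)).norm
        simpa using this
      have he : ∀ n : ℕ, ∫ t : ℝ, ‖1 / ((n : ℂ) + 1) ^ (1 + s) * ((a (t - Real.log (n + 1)) : ℂ) *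
          cexp (-(s * ((t - Real.log (n + 1) : ℝ) : ℂ))))‖ = ‖1 / ((n : ℂ) + 1) ^ (1 + s)‖ *
          ∫ t : ℝ, ‖(a t : ℂ) * cexp (-(s * t))‖ := by
        intro n
        rw [← integral_sub_right_eq_self (fun t : ℝ => ‖(a t : ℂ) * cexp (-(s * t))‖)
          (Real.log (n + 1)), ← integral_const_mul]
        congr 1 with t
        rw [norm_mul]
      simp_rw [he]
      exact hz.mul_right _)
  have hLHS : (fun t : ℝ => ∑' n : ℕ, 1 / ((n : ℂ) + 1) ^ (1 + s) *
        ((a (t - Real.log (n + 1)) : ℂ) * cexp (-(s * ((t - Real.log (n + 1) : ℝ) : ℂ))))) =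
      fun t : ℝ => ((Real.exp (-t) * dilationSum g (Real.exp t) : ℝ) : ℂ) * cexp (-(s * t)) := by
    ext t
    simp_rw [← hterm]
    rw [tsum_eq_sum (s := Finset.range ⌊Real.exp t⌋₊) fun n hn => by
      rw [eq_zero_of_natFloor_le hg (by simpa using hn)]; simp,
      dilationSum_eq_sum_range hg le_rfl, Finset.mul_sum, ofReal_sum, Finset.sum_mul]
  rw [hLHS] at hsum
  have hval : ∀ n : ℕ, ∫ t : ℝ, 1 / ((n : ℂ) + 1) ^ (1 + s) * ((a (t - Real.log (n + 1)) : ℂ) *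
          cexp (-(s * ((t - Real.log (n + 1) : ℝ) : ℂ)))) =
        1 / ((n : ℂ) + 1) ^ (1 + s) * laplace a s := by
    intro n
    rw [integral_const_mul]
    congr 1
    exact integral_sub_right_eq_self (fun t : ℝ => (a t : ℂ) * cexp (-(s * t)))
      (Real.log (n + 1))
  simp_rw [hval] at hsum
  rw [laplace, ← hsum.tsum_eq, tsum_mul_right,
    zeta_eq_tsum_one_div_nat_add_one_cpow (by simpa using hs)]

/-! ### The analytic continuation across the line `Re s = 0` -/

/-- The entire function `s ζ(1 + s)`. -/
noncomputable def shiftedZeta (s : ℂ) : ℂ := DirichletCharacter.LFunctionTrivChar₁ 1 (1 + s)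

lemma shiftedZeta_zero : shiftedZeta 0 = 1 := by
  simp [shiftedZeta]

lemma shiftedZeta_of_ne_zero {s : ℂ} (hs : s ≠ 0) : shiftedZeta s = s * riemannZeta (1 + s) := by
  rw [shiftedZeta, DirichletCharacter.LFunctionTrivChar₁, Function.update_of_ne (by simpa using hs)]
  simp [DirichletCharacter.LFunctionTrivChar, DirichletCharacter.LFunction_modOne_eq]

lemma differentiable_shiftedZeta : Differentiable ℂ shiftedZeta :=
  (DirichletCharacter.differentiable_LFunctionTrivChar₁ 1).comp (by fun_prop)

lemma shiftedZeta_ne_zero {s : ℂ} (hs : 0 ≤ s.re) : shiftedZeta s ≠ 0 := by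
  rcases eq_or_ne s 0 with rfl | h
  · simp [shiftedZeta_zero]
  · rw [shiftedZeta_of_ne_zero h]
    exact mul_ne_zero h (riemannZeta_ne_zero_of_one_le_re (by simpa using hs))

/-- Solving `ζ(1 + s) L(s) = A / s² + B / s + E(s)` for `L(s) - A / s`: the result is an affine
function of `E(s)` with coefficients analytic up to the line `Re s = 0`, because `ζ` does not
vanish on `Re s = 1`. -/
lemma exists_analytic_sub_div_eq (A B : ℝ) : ∃ R m : ℂ → ℂ,
    AnalyticOnNhd ℂ R rightHalfPlane ∧ AnalyticOnNhd ℂ m rightHalfPlane ∧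
    ∀ s L E : ℂ, 0 < s.re → riemannZeta (1 + s) * L = B / s + A / s ^ 2 + E →
      L - A / s = R s + m s * E := by
  have hZ : AnalyticOnNhd ℂ shiftedZeta rightHalfPlane :=
    fun s _ => differentiable_shiftedZeta.analyticAt s
  have hD : AnalyticOnNhd ℂ (dslope shiftedZeta 0) rightHalfPlane := by
    have : DifferentiableOn ℂ (dslope shiftedZeta 0) Set.univ :=
      (differentiableOn_dslope univ_mem).mpr differentiable_shiftedZeta.differentiableOn
    exact fun s _ => (differentiableOn_univ.mp this).analyticAt s
  refine ⟨fun s => (B - A * dslope shiftedZeta 0 s) / shiftedZeta s, fun s => s / shiftedZeta s,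
    ?_, ?_, fun s L E hs h => ?_⟩
  · exact (analyticOnNhd_const.sub (analyticOnNhd_const.mul hD)).div hZ
      fun s hs => shiftedZeta_ne_zero hs
  · exact analyticOnNhd_id.div hZ fun s hs => shiftedZeta_ne_zero hs
  · have hs0 : s ≠ 0 := fun h => by simp [h] at hs
    have hz := shiftedZeta_ne_zero hs.le
    have hL : shiftedZeta s * L = B + A / s + s * E := by
      rw [shiftedZeta_of_ne_zero hs0, mul_assoc, h]; field_simp
    have hds : s * dslope shiftedZeta 0 s = shiftedZeta s - 1 := by
      rw [dslope_of_ne _ hs0, slope_def_field, shiftedZeta_zero, sub_zero]; field_simp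
    simp only
    rw [← mul_right_inj' (mul_ne_zero hz hs0)]
    field_simp
    field_simp at hL
    linear_combination hL + A * hds

/-! ### Convolution with a band-limited kernel -/

/-- The Laplace transform on the line `Re s = σ`, smoothed by `k m`, is the convolution of
`c(t) e^{-σt}` with the oscillatory integral of `k m`. -/
lemma integrable_and_oscInt_mul_laplace {k : ℝ → ℂ} {m : ℂ → ℂ} (hk : Continuous k)
    (hks : HasCompactSupport k) (hm : ContinuousOn m rightHalfPlane) {c : ℝ → ℝ}
    (hc : Measurable c) (h0 : ∀ t < 0, c t = 0) {M : ℝ} (hM : ∀ t, |c t| ≤ M) {σ : ℝ}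
    (hσ : 0 < σ) (x : ℝ) :
    Integrable (fun u : ℝ => k u * (m (σ + u * I) * laplace c (σ + u * I)) *
      cexp (u * x * I)) ∧
    oscInt k (fun s => m s * laplace c s) σ x =
      ∫ t : ℝ, ((c t * Real.exp (-(σ * t)) : ℝ) : ℂ) * oscInt k m σ (x - t) := by
  have hM0 : 0 ≤ M := (abs_nonneg _).trans (hM 0)
  have hw : Integrable fun u : ℝ => k u * m (σ + u * I) :=
    integrable_mul_comp_line hk hks hm hσ.le
  have hv : Integrable fun t : ℝ => (c t : ℂ) * cexp (-((σ : ℂ) * t)) :=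
    integrable_mul_cexp_neg (M := M) hc h0 (fun t => by nlinarith [hM t, abs_nonneg t])
      (by simpa using hσ)
  have hf : Integrable (Function.uncurry fun u t : ℝ => k u * m (σ + u * I) *
      ((c t : ℂ) * cexp (-((σ : ℂ) * t))) * cexp (u * ((x - t : ℝ) : ℂ) * I))
      (volume.prod volume) := by
    refine (hw.mul_prod hv).mono ((hw.mul_prod hv).aestronglyMeasurable.mul ?_)
      (ae_of_all _ fun p => ?_)
    · exact Continuous.aestronglyMeasurable (by fun_prop)
    · simp only [Function.uncurry]
      rw [norm_mul _ (cexp _), norm_cexp_mul_mul_I, mul_one]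
  have hin : ∀ u : ℝ, ∫ t : ℝ, k u * m (σ + u * I) *
      ((c t : ℂ) * cexp (-((σ : ℂ) * t))) * cexp (u * ((x - t : ℝ) : ℂ) * I) =
      k u * (m (σ + u * I) * laplace c (σ + u * I)) * cexp (u * x * I) := by
    intro u
    rw [show k u * (m (σ + u * I) * laplace c (σ + u * I)) * cexp (u * x * I) =
      k u * m (σ + u * I) * cexp (u * x * I) * laplace c (σ + u * I) by ring, laplace,
      ← integral_const_mul]
    congr 1 with t
    have : cexp (-((σ : ℂ) * t)) * cexp (u * ((x - t : ℝ) : ℂ) * I) =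
        cexp (u * x * I) * cexp (-((σ + u * I) * t)) := by
      rw [← Complex.exp_add, ← Complex.exp_add]; push_cast; ring_nf
    linear_combination (k u * m (σ + u * I) * c t) * this
  constructor
  · have := hf.integral_prod_left
    simp only [Function.uncurry] at this
    simpa only [hin] using this
  · have := integral_integral_swap hf
    simp only [hin] at this
    rw [oscInt, this]
    congr 1 with t
    rw [oscInt, ← integral_const_mul]
    congr 1 with u
    push_cast
    ring

/-- Smoothing a bounded function against an integrable one preserves its limit at infinity, up to
the mass of the kernel. -/
lemma tendsto_integral_comp_sub_mul {e : ℝ → ℝ} (he : Measurable e) {M l : ℝ}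
    (hM : ∀ t, |e t| ≤ M) (hlim : Tendsto e atTop (𝓝 l)) {κ : ℝ → ℝ} (hκ : Integrable κ)
    {r : ℝ} :
    Tendsto (fun x => ∫ y, e (x - r * y) * κ y) atTop (𝓝 (l * ∫ y, κ y)) := by
  rw [← integral_const_mul]
  refine tendsto_integral_filter_of_dominated_convergence (fun y => M * ‖κ y‖)
    (Eventually.of_forall fun x => ?_) (Eventually.of_forall fun x => ae_of_all _ fun y => ?_)
    (hκ.norm.const_mul M) (ae_of_all _ fun y => ?_)
  · exact (Measurable.aestronglyMeasurable (by fun_prop)).mul hκ.aestronglyMeasurable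
  · rw [norm_mul]
    exact mul_le_mul_of_nonneg_right (hM _) (norm_nonneg _)
  · exact (hlim.comp (tendsto_atTop_add_const_right _ _ tendsto_id)).mul_const _

/-- The boundary behaviour of the Laplace transform controls the convolution with a band-limited
kernel. All estimates on the lines `Re s = σ` are uniform in `σ ∈ (0, 1]`, so no boundary values
of the transform of `e` are needed. -/
lemma tendsto_integral_mul_oscInt {b e : ℝ → ℝ} (hb : Measurable b) (hb0 : ∀ t < 0, b t = 0)
    {M : ℝ} (hbM : ∀ t, |b t| ≤ M) (he : Measurable e) (he0 : ∀ t < 0, e t = 0)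
    {M' : ℝ} (heM : ∀ t, |e t| ≤ M') (helim : Tendsto e atTop (𝓝 0)) {R m : ℂ → ℂ}
    (hR : AnalyticOnNhd ℂ R rightHalfPlane) (hm : AnalyticOnNhd ℂ m rightHalfPlane)
    (h : ∀ s : ℂ, 0 < s.re → laplace b s = R s + m s * laplace e s)
    {k : ℝ → ℂ} (hk : ContDiff ℝ ∞ k) (hks : HasCompactSupport k) :
    Tendsto (fun x : ℝ => ∫ t : ℝ, (b t : ℂ) * oscInt k (fun _ => 1) 0 (x - t)) atTop
      (𝓝 0) := by
  obtain ⟨C0, hC0, H0⟩ := exists_norm_oscInt_le_inv_one_add_sq hk hks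
    (m := fun _ => 1) analyticOnNhd_const
  obtain ⟨C1, hC1, H1⟩ := exists_norm_oscInt_le_inv_one_add_sq hk hks hR
  obtain ⟨C2, hC2, H2⟩ := exists_norm_oscInt_le_inv_one_add_sq hk hks hm
  have hconst : ∀ σ y : ℝ, oscInt k (fun _ => 1) σ y = oscInt k (fun _ => 1) 0 y :=
    fun σ y => rfl
  set K : ℝ → ℂ := oscInt k (fun _ => 1) 0 with hK
  have hid : ∀ σ : ℝ, 0 < σ → ∀ x : ℝ,
      ∫ t : ℝ, ((b t * Real.exp (-(σ * t)) : ℝ) : ℂ) * K (x - t) = oscInt k R σ x +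
        ∫ t : ℝ, ((e t * Real.exp (-(σ * t)) : ℝ) : ℂ) * oscInt k m σ (x - t) := by
    intro σ hσ x
    obtain ⟨-, q1⟩ := integrable_and_oscInt_mul_laplace (m := fun _ => 1) hk.continuous hks
      continuousOn_const hb hb0 hbM hσ x
    obtain ⟨i2, q2⟩ := integrable_and_oscInt_mul_laplace hk.continuous hks
      hm.continuousOn he he0 heM hσ x
    simp only [hconst] at q1
    rw [← q1, ← q2]
    simp only [oscInt]
    rw [← integral_add (integrable_oscInt hk.continuous hks hR.continuousOn hσ.le x) i2]
    congr 1 with u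
    rw [h _ (by simpa using hσ)]
    ring
  have hKint : ∀ x : ℝ, Integrable fun t : ℝ => (1 + (x - t) ^ 2)⁻¹ :=
    fun x => integrable_inv_one_add_sq.comp_sub_left x
  have hexp : ∀ σ t : ℝ, 0 ≤ σ → 0 ≤ t → Real.exp (-(σ * t)) ≤ 1 := fun σ t h1 h2 => by
    rw [Real.exp_le_one_iff]; nlinarith [mul_nonneg h1 h2]
  have hKcont : Continuous K := by
    refine continuous_of_dominated (bound := fun u => ‖k u‖) (fun y => ?_)
      (fun y => ae_of_all _ fun u => ?_) (hk.continuous.integrable_of_hasCompactSupport hks).norm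
      (ae_of_all _ fun u => by fun_prop)
    · have := hk.continuous
      exact Continuous.aestronglyMeasurable (by fun_prop)
    · rw [norm_mul, norm_cexp_mul_mul_I, mul_one, mul_one]
  have hbound : ∀ σ ∈ Set.Ioc (0 : ℝ) 1, ∀ x : ℝ,
      ‖∫ t : ℝ, ((b t * Real.exp (-(σ * t)) : ℝ) : ℂ) * K (x - t)‖ ≤
        C1 * (1 + x ^ 2)⁻¹ + C2 * ∫ y : ℝ, |e (x - 1 * y)| * (1 + y ^ 2)⁻¹ := by
    intro σ hσ x
    have hσ' : σ ∈ Set.Icc (0 : ℝ) 1 := ⟨hσ.1.le, hσ.2⟩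
    rw [hid σ hσ.1 x]
    refine (norm_add_le _ _).trans (add_le_add (H1 σ hσ' x) ?_)
    rw [← integral_sub_left_eq_self (fun y => |e (x - 1 * y)| * (1 + y ^ 2)⁻¹) volume x,
      ← integral_const_mul]
    refine norm_integral_le_of_norm_le ?_ (ae_of_all _ fun t => ?_)
    · refine Integrable.const_mul ?_ _
      refine (hKint x).bdd_mul (c := M') (Measurable.aestronglyMeasurable (by fun_prop))
        (ae_of_all _ fun t => ?_)
      rw [Real.norm_eq_abs, abs_abs]; exact heM _
    · rw [norm_mul, norm_real, norm_mul, Real.norm_eq_abs, Real.norm_eq_abs, Real.abs_exp,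
        one_mul, sub_sub_cancel]
      rcases lt_or_ge t 0 with ht | ht
      · simp [he0 t ht]
      · calc |e t| * Real.exp (-(σ * t)) * ‖oscInt k m σ (x - t)‖
            ≤ |e t| * 1 * (C2 * (1 + (x - t) ^ 2)⁻¹) := by
              gcongr
              · exact hexp σ t hσ.1.le ht
              · exact H2 σ hσ' _
          _ = _ := by ring
  have hlimσ : ∀ x : ℝ, Tendsto (fun σ : ℝ =>
      ∫ t : ℝ, ((b t * Real.exp (-(σ * t)) : ℝ) : ℂ) * K (x - t)) (𝓝[>] 0)
      (𝓝 (∫ t : ℝ, (b t : ℂ) * K (x - t))) := by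
    intro x
    refine tendsto_integral_filter_of_dominated_convergence
      (fun t => M * (C0 * (1 + (x - t) ^ 2)⁻¹)) ?_ ?_ (((hKint x).const_mul _).const_mul _)
      (ae_of_all _ fun t => ?_)
    · refine Eventually.of_forall fun σ => Measurable.aestronglyMeasurable ?_
      have := hKcont.measurable
      fun_prop
    · filter_upwards [self_mem_nhdsWithin] with σ hσ
      refine ae_of_all _ fun t => ?_
      have hM0 : 0 ≤ M := (abs_nonneg _).trans (hbM 0)
      rw [norm_mul, norm_real, norm_mul, Real.norm_eq_abs, Real.norm_eq_abs, Real.abs_exp]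
      rcases lt_or_ge t 0 with ht | ht
      · rw [hb0 t ht]; simp; positivity
      · calc |b t| * Real.exp (-(σ * t)) * ‖K (x - t)‖
            ≤ M * 1 * (C0 * (1 + (x - t) ^ 2)⁻¹) := by
              gcongr
              · exact hbM t
              · exact hexp σ t (le_of_lt hσ) ht
              · exact H0 0 (by simp) _
          _ = _ := by ring
    · have : Continuous fun σ : ℝ => ((b t * Real.exp (-(σ * t)) : ℝ) : ℂ) * K (x - t) := by
        fun_prop
      simpa using (this.tendsto 0).mono_left nhdsWithin_le_nhds
  have hfin : ∀ x : ℝ, ‖∫ t : ℝ, (b t : ℂ) * K (x - t)‖ ≤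
      C1 * (1 + x ^ 2)⁻¹ + C2 * ∫ y : ℝ, |e (x - 1 * y)| * (1 + y ^ 2)⁻¹ := by
    intro x
    refine le_of_tendsto (hlimσ x).norm ?_
    filter_upwards [Ioc_mem_nhdsGT (zero_lt_one (α := ℝ))] with σ hσ
    exact hbound σ hσ x
  refine squeeze_zero_norm hfin ?_
  have t1 : Tendsto (fun x : ℝ => C1 * (1 + x ^ 2)⁻¹) atTop (𝓝 0) := by
    rw [← mul_zero C1]
    exact (tendsto_inv_atTop_zero.comp (tendsto_atTop_add_const_left _ _
      (tendsto_pow_atTop two_ne_zero))).const_mul _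
  have t2 := (tendsto_integral_comp_sub_mul (r := 1) (M := M') (he.abs) (by simpa using heM)
    (by simpa using helim.abs) integrable_inv_one_add_sq).const_mul C2
  simpa using t1.add t2

/-! ### A non-negative band-limited kernel -/

/-- The kernel is the square of the Fourier transform of an even real bump function; it is the
Fourier transform of the convolution of the bump function with itself. -/
lemma exists_nonneg_bandLimited_kernel : ∃ (k : ℝ → ℂ) (K : ℝ → ℝ), ContDiff ℝ ∞ k ∧
    HasCompactSupport k ∧ (∀ y, oscInt k (fun _ => 1) 0 y = K y) ∧ (∀ y, 0 ≤ K y) ∧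
    Integrable K ∧ 0 < ∫ y, K y := by
  let φ : ContDiffBump (0 : ℝ) := ⟨1, 2, one_pos, one_lt_two⟩
  set p : ℝ → ℂ := fun u => (φ u : ℂ) with hp
  have hpc : ContDiff ℝ ∞ p := ofRealCLM.contDiff.comp φ.contDiff
  have hps : HasCompactSupport p := φ.hasCompactSupport.comp_left ofReal_zero
  have hpi : ∀ y : ℝ, Integrable fun u : ℝ => p u * cexp (u * y * I) := fun y =>
    (hpc.continuous.mul (by fun_prop)).integrable_of_hasCompactSupport hps.mul_right
  set Φ : ℝ → ℂ := fun y => ∫ u, p u * cexp (u * y * I) with hΦ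
  have hreal : ∀ y, ((Φ y).re : ℂ) = Φ y := by
    intro y
    rw [← conj_eq_iff_re, hΦ]
    simp only
    rw [← integral_conj, ← integral_neg_eq_self]
    congr 1 with u
    rw [map_mul, ← Complex.exp_conj]
    simp [hp, φ.neg]
  set k : ℝ → ℂ := convolution p p (ContinuousLinearMap.mul ℝ ℂ) volume with hk
  have hkc : ContDiff ℝ ∞ k :=
    hps.contDiff_convolution_left _ hpc (hpc.continuous.locallyIntegrable)
  have hks : HasCompactSupport k := hps.convolution _ hps
  have hK : ∀ y : ℝ, oscInt k (fun _ => 1) 0 y = (((Φ y).re ^ 2 : ℝ) : ℂ) := by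
    intro y
    have h := integral_convolution (ContinuousLinearMap.mul ℝ ℂ) (hpi y) (hpi y)
    rw [ofReal_pow, hreal, sq]
    refine Eq.trans ?_ h
    unfold oscInt
    congr 1 with u
    rw [hk, convolution_def, convolution_def, mul_one, ← integral_mul_const]
    congr 1 with v
    have : cexp (u * y * I) = cexp (v * y * I) * cexp ((u - v : ℝ) * y * I) := by
      rw [← Complex.exp_add]; push_cast; ring_nf
    simp only [ContinuousLinearMap.mul_apply']
    rw [this]
    ring
  have hΦcont : Continuous Φ := by
    refine continuous_of_dominated (bound := fun u => ‖p u‖) (fun y => (hpi y).1)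
      (fun y => ae_of_all _ fun u => ?_)
      (hpc.continuous.integrable_of_hasCompactSupport hps).norm
      (ae_of_all _ fun u => by fun_prop)
    rw [norm_mul, norm_cexp_mul_mul_I, mul_one]
  have hKcont : Continuous fun y => (Φ y).re ^ 2 := (continuous_re.comp hΦcont).pow 2
  have hKint : Integrable fun y => (Φ y).re ^ 2 := by
    obtain ⟨C, hC, H⟩ := exists_norm_oscInt_le_inv_one_add_sq hkc hks
      (m := fun _ => 1) analyticOnNhd_const
    refine (integrable_inv_one_add_sq.const_mul C).mono' hKcont.aestronglyMeasurable
      (ae_of_all _ fun y => ?_)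
    simpa [hK] using H 0 (by simp) y
  refine ⟨k, fun y => (Φ y).re ^ 2, hkc, hks, hK, fun y => sq_nonneg _, hKint, ?_⟩
  refine integral_pos_of_integrable_nonneg_nonzero (x := 0) hKcont hKint
    (fun y => sq_nonneg _) ?_
  have h0 : Φ 0 = ((∫ u, φ u : ℝ) : ℂ) := by
    simp only [hΦ, hp]
    rw [← integral_complex_ofReal]
    simp
  simp only [h0, ofReal_re]
  exact pow_ne_zero _ φ.integral_pos.ne'

/-- Rescaling the frequency variable rescales the kernel. -/
lemma oscInt_comp_mul_left (k : ℝ → ℂ) {r : ℝ} (hr : 0 < r) (y : ℝ) :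
    oscInt (fun u => k (r * u)) (fun _ => 1) 0 y = r⁻¹ * oscInt k (fun _ => 1) 0 (r⁻¹ * y) := by
  have h := Measure.integral_comp_mul_left
    (fun u : ℝ => k u * 1 * cexp (u * ((r⁻¹ * y : ℝ) : ℂ) * I)) r
  rw [abs_of_pos (inv_pos.mpr hr), real_smul] at h
  refine Eq.trans ?_ h
  unfold oscInt
  congr 1 with u
  have hrc : (r : ℂ) ≠ 0 := ofReal_ne_zero.mpr hr.ne'
  congr 2
  push_cast
  field_simp

/-- The band-limited smoothings at every scale, in real form. -/
lemma tendsto_integral_comp_sub_mul_kernel {b e : ℝ → ℝ} (hb : Measurable b)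
    (hb0 : ∀ t < 0, b t = 0)
    {M : ℝ} (hbM : ∀ t, |b t| ≤ M) (he : Measurable e) (he0 : ∀ t < 0, e t = 0)
    {M' : ℝ} (heM : ∀ t, |e t| ≤ M') (helim : Tendsto e atTop (𝓝 0)) {R m : ℂ → ℂ}
    (hR : AnalyticOnNhd ℂ R rightHalfPlane) (hm : AnalyticOnNhd ℂ m rightHalfPlane)
    (h : ∀ s : ℂ, 0 < s.re → laplace b s = R s + m s * laplace e s)
    {k : ℝ → ℂ} {K : ℝ → ℝ} (hk : ContDiff ℝ ∞ k) (hks : HasCompactSupport k)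
    (hK : ∀ y, oscInt k (fun _ => 1) 0 y = K y) {r : ℝ} (hr : 0 < r) :
    Tendsto (fun x : ℝ => ∫ y, b (x - r * y) * K y) atTop (𝓝 0) := by
  have hkr : ContDiff ℝ ∞ fun u => k (r * u) := hk.comp (by fun_prop)
  have hksr : HasCompactSupport fun u => k (r * u) :=
    hks.comp_homeomorph (Homeomorph.mulLeft₀ r hr.ne')
  have H := tendsto_integral_mul_oscInt hb hb0 hbM he he0 heM helim hR hm h hkr hksr
  have e1 : ∀ x : ℝ, ∫ t : ℝ, (b t : ℂ) * oscInt (fun u => k (r * u)) (fun _ => 1) 0 (x - t) =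
      ((∫ y, b (x - r * y) * K y : ℝ) : ℂ) := by
    intro x
    have h1 := Measure.integral_comp_mul_left
      (fun t : ℝ => b (x - t) * (r⁻¹ * K (r⁻¹ * t))) r
    have h2 := integral_sub_left_eq_self
      (fun t : ℝ => b (x - t) * (r⁻¹ * K (r⁻¹ * t))) volume x
    simp only [sub_sub_cancel] at h2
    have h3 : ∫ y, b (x - r * y) * K y = ∫ t, b t * (r⁻¹ * K (r⁻¹ * (x - t))) := by
      rw [h2]
      rw [abs_of_pos (inv_pos.mpr hr), smul_eq_mul, eq_inv_mul_iff_mul_eq₀ hr.ne'] at h1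
      rw [← h1, ← integral_const_mul]
      congr 1 with y
      field_simp
    rw [h3, ← integral_complex_ofReal]
    congr 1 with t
    rw [oscInt_comp_mul_left k hr, hK]
    push_cast
    ring
  simp only [e1] at H
  exact_mod_cast (continuous_re.tendsto _).comp H

/-! ### The Tauberian step -/

/-- A bounded non-negative function that cannot decrease faster than `e^{-t}` tends to `A` as soon
as its smoothings at all scales by one non-negative kernel do. -/
lemma tendsto_of_tendsto_smoothings {a K : ℝ → ℝ} (ha : Measurable a) (ha0 : ∀ t, 0 ≤ a t)
    {M : ℝ} (haM : ∀ t, a t ≤ M) (hdec : ∀ t d, 0 ≤ d → Real.exp (-d) * a t ≤ a (t + d))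
    (hK0 : ∀ y, 0 ≤ K y) (hKi : Integrable K) (hKpos : 0 < ∫ y, K y) {A : ℝ}
    (h : ∀ r > 0, Tendsto (fun x => ∫ y, a (x - r * y) * K y) atTop (𝓝 (A * ∫ y, K y))) :
    Tendsto a atTop (𝓝 A) := by
  set c := ∫ y, K y with hc
  have hM0 : 0 ≤ M := (ha0 0).trans (haM 0)
  have hint : ∀ r x : ℝ, Integrable fun y => a (x - r * y) * K y := fun r x =>
    hKi.bdd_mul (c := M) (Measurable.aestronglyMeasurable (by fun_prop))
      (ae_of_all _ fun y => by rw [Real.norm_eq_abs, abs_of_nonneg (ha0 _)]; exact haM _)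
  -- Most of the mass of `K` lies in `[-Y, Y]`; the scale is then chosen so that this window
  -- becomes `[-δ, δ]`.
  have hmass : ∀ δ ∈ Set.Ioo (0 : ℝ) 1, ∃ Y > 0,
      (1 - δ) * c ≤ ∫ y in Set.Icc (-Y) Y, K y := by
    intro δ hδ
    have h1 : Tendsto (fun Y : ℝ => ∫ y in Set.Icc (-Y) Y, K y) atTop (𝓝 c) :=
      (aecover_Icc tendsto_neg_atTop_atBot tendsto_id).integral_tendsto_of_countably_generated hKi
    have h2 : (1 - δ) * c < c := by nlinarith [hδ.1]
    obtain ⟨Y, hY, hY0⟩ := ((h1.eventually_const_lt h2).and (eventually_gt_atTop 0)).exists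
    exact ⟨Y, hY0, hY.le⟩
  have hupper : ∀ δ ∈ Set.Ioo (0 : ℝ) 1, ∀ᶠ x in atTop,
      a x ≤ (A + δ) / (Real.exp (-(2 * δ)) * (1 - δ)) := by
    intro δ hδ
    obtain ⟨Y, hY, hmY⟩ := hmass δ hδ
    have hr : 0 < δ / Y := div_pos hδ.1 hY
    have h1 : A * c < (A + δ) * c := by nlinarith [mul_pos hδ.1 hKpos]
    filter_upwards [((h _ hr).comp (tendsto_atTop_add_const_right _ δ tendsto_id)).eventually_lt_const
      h1] with x hx
    have hwin : Real.exp (-(2 * δ)) * a x * ∫ y in Set.Icc (-Y) Y, K y ≤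
        ∫ y, a (x + δ - δ / Y * y) * K y := by
      rw [← integral_const_mul]
      refine le_trans (setIntegral_mono_on (hKi.integrableOn.const_mul _)
        (hint _ _).integrableOn measurableSet_Icc fun y hy => ?_)
        (setIntegral_le_integral (hint _ _) (ae_of_all _ fun y => mul_nonneg (ha0 _) (hK0 _)))
      refine mul_le_mul_of_nonneg_right ?_ (hK0 _)
      have e1 : |δ / Y * y| ≤ δ := by
        rw [abs_mul, abs_of_pos hr, div_mul_eq_mul_div, div_le_iff₀ hY]
        exact mul_le_mul_of_nonneg_left (abs_le.mpr hy) hδ.1.le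
      have e2 := abs_le.mp e1
      have e3 := hdec x (δ - δ / Y * y) (by linarith)
      rw [← add_sub_assoc] at e3
      refine le_trans (mul_le_mul_of_nonneg_right ?_ (ha0 _)) e3
      exact Real.exp_le_exp.mpr (by linarith)
    have hE : 0 < Real.exp (-(2 * δ)) := Real.exp_pos _
    rw [le_div_iff₀ (mul_pos hE (by linarith [hδ.2]))]
    have e4 : Real.exp (-(2 * δ)) * a x * ((1 - δ) * c) < (A + δ) * c :=
      ((mul_le_mul_of_nonneg_left hmY (mul_nonneg hE.le (ha0 x))).trans hwin).trans_lt hx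
    have e5 : a x * (Real.exp (-(2 * δ)) * (1 - δ)) * c < (A + δ) * c := by
      calc _ = Real.exp (-(2 * δ)) * a x * ((1 - δ) * c) := by ring
        _ < _ := e4
    exact (lt_of_mul_lt_mul_right e5 hKpos.le).le
  have hlower : ∀ δ ∈ Set.Ioo (0 : ℝ) 1, ∀ᶠ x in atTop,
      (A - δ - M * δ) * Real.exp (-(2 * δ)) ≤ a x := by
    intro δ hδ
    obtain ⟨Y, hY, hmY⟩ := hmass δ hδ
    have hr : 0 < δ / Y := div_pos hδ.1 hY
    have h1 : (A - δ) * c < A * c := by nlinarith [mul_pos hδ.1 hKpos]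
    filter_upwards [((h _ hr).comp (tendsto_atTop_add_const_right _ (-δ) tendsto_id)).eventually_const_lt
      h1] with x hx
    have hwin : ∫ y, a (x + -δ - δ / Y * y) * K y ≤
        Real.exp (2 * δ) * a x * c + M * (δ * c) := by
      rw [← integral_add_compl (measurableSet_Icc (a := -Y) (b := Y)) (hint _ _)]
      refine add_le_add ?_ ?_
      · have e0 : ∫ y in Set.Icc (-Y) Y, a (x + -δ - δ / Y * y) * K y ≤
            ∫ y in Set.Icc (-Y) Y, Real.exp (2 * δ) * a x * K y := by
          refine setIntegral_mono_on (hint _ _).integrableOn (hKi.integrableOn.const_mul _)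
            measurableSet_Icc fun y hy => ?_
          refine mul_le_mul_of_nonneg_right ?_ (hK0 _)
          have e1 : |δ / Y * y| ≤ δ := by
            rw [abs_mul, abs_of_pos hr, div_mul_eq_mul_div, div_le_iff₀ hY]
            exact mul_le_mul_of_nonneg_left (abs_le.mpr hy) hδ.1.le
          have e2 := abs_le.mp e1
          have e3 := hdec (x + -δ - δ / Y * y) (δ + δ / Y * y) (by linarith)
          rw [show x + -δ - δ / Y * y + (δ + δ / Y * y) = x by ring] at e3
          have e4 : a (x + -δ - δ / Y * y) ≤ Real.exp (δ + δ / Y * y) * a x := by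
            rw [Real.exp_neg] at e3
            rwa [inv_mul_le_iff₀ (Real.exp_pos _)] at e3
          exact e4.trans (mul_le_mul_of_nonneg_right
            (Real.exp_le_exp.mpr (by linarith)) (ha0 _))
        refine e0.trans ?_
        rw [integral_const_mul]
        exact mul_le_mul_of_nonneg_left (setIntegral_le_integral hKi (ae_of_all _ hK0))
          (mul_nonneg (Real.exp_pos _).le (ha0 _))
      · have e0 : ∫ y in (Set.Icc (-Y) Y)ᶜ, a (x + -δ - δ / Y * y) * K y ≤
            ∫ y in (Set.Icc (-Y) Y)ᶜ, M * K y :=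
          setIntegral_mono_on (hint _ _).integrableOn (hKi.integrableOn.const_mul _)
            measurableSet_Icc.compl fun y _ => mul_le_mul_of_nonneg_right (haM _) (hK0 _)
        refine e0.trans ?_
        rw [integral_const_mul]
        refine mul_le_mul_of_nonneg_left ?_ hM0
        have := integral_add_compl (measurableSet_Icc (a := -Y) (b := Y)) hKi
        linarith
    have e4 : (A - δ - M * δ) * c ≤ Real.exp (2 * δ) * a x * c := by
      have : (A - δ) * c < ∫ y, a (x + -δ - δ / Y * y) * K y := hx
      linarith
    have e5 := le_of_mul_le_mul_right e4 hKpos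
    rw [Real.exp_neg, ← div_eq_mul_inv, div_le_iff₀ (Real.exp_pos _), mul_comm (a x)]
    exact e5
  have hnear : ∀ᶠ δ : ℝ in 𝓝[>] 0, δ ∈ Set.Ioo (0 : ℝ) 1 := Ioo_mem_nhdsGT one_pos
  rw [tendsto_order]
  constructor
  · intro l hl
    have hlim : Tendsto (fun δ : ℝ => (A - δ - M * δ) * Real.exp (-(2 * δ))) (𝓝[>] 0) (𝓝 A) := by
      have : Continuous fun δ : ℝ => (A - δ - M * δ) * Real.exp (-(2 * δ)) := by fun_prop
      simpa using (this.tendsto 0).mono_left nhdsWithin_le_nhds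
    obtain ⟨δ, hδ1, hδ2⟩ := ((hlim.eventually_const_lt hl).and hnear).exists
    filter_upwards [hlower δ hδ2] with x hx using hδ1.trans_le hx
  · intro l hl
    have hlim : Tendsto (fun δ : ℝ => (A + δ) / (Real.exp (-(2 * δ)) * (1 - δ))) (𝓝[>] 0)
        (𝓝 A) := by
      have : ContinuousAt (fun δ : ℝ => (A + δ) / (Real.exp (-(2 * δ)) * (1 - δ))) 0 :=
        ContinuousAt.div (by fun_prop) (by fun_prop) (by simp)
      simpa using this.tendsto.mono_left nhdsWithin_le_nhds
    obtain ⟨δ, hδ1, hδ2⟩ := ((hlim.eventually_lt_const hl).and hnear).exists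
    filter_upwards [hupper δ hδ2] with x hx using hx.trans_lt hδ1

/-! ### The theorem in logarithmic coordinates -/

lemma monotone_dilationSum {g : ℝ → ℝ} (hg : ∀ x < 1, g x = 0) (hmono : Monotone g) :
    Monotone (dilationSum g) := by
  intro x y hxy
  rw [dilationSum_eq_sum_range hg (Nat.floor_mono hxy), dilationSum_eq_sum_range hg le_rfl]
  exact Finset.sum_le_sum fun n _ => hmono (by gcongr)

lemma dilationSum_nonneg {g : ℝ → ℝ} (h0 : ∀ x, 0 ≤ g x) (x : ℝ) : 0 ≤ dilationSum g x :=
  Finset.sum_nonneg fun _ _ => h0 _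

lemma dilationSum_of_lt {g : ℝ → ℝ} {x : ℝ} (hx : x < 1) : dilationSum g x = 0 := by
  simp [dilationSum, Nat.floor_eq_zero.mpr hx]

/-- A function on the half-line, extended by zero, that is bounded on bounded intervals and has a
limit at infinity is bounded. -/
lemma exists_abs_le_of_tendsto {e : ℝ → ℝ} (he0 : ∀ t < 0, e t = 0)
    (hloc : ∀ T, ∃ D, ∀ t, 0 ≤ t → t ≤ T → |e t| ≤ D) {l : ℝ} (hlim : Tendsto e atTop (𝓝 l)) :
    ∃ M, ∀ t, |e t| ≤ M := by
  obtain ⟨T, hT⟩ := eventually_atTop.mp (hlim.abs.eventually_le_const (lt_add_one |l|))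
  obtain ⟨D, hD⟩ := hloc T
  refine ⟨max (|l| + 1) D, fun t => ?_⟩
  rcases lt_or_ge t 0 with h0 | h0
  · rw [he0 t h0, abs_zero]
    exact le_max_of_le_left (by positivity)
  · rcases le_total T t with h1 | h1
    · exact le_max_of_le_left (hT t h1)
    · exact le_max_of_le_right (hD t h0 h1)

lemma tendsto_exp_neg_mul_of_dilationSum {g : ℝ → ℝ} (hg : ∀ x < 1, g x = 0)
    (hmono : Monotone g) (h0 : ∀ x, 0 ≤ g x) {A B : ℝ}
    (hF : (fun x : ℝ => dilationSum g x - (A * x * Real.log x + B * x)) =o[atTop]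
      (fun x : ℝ => x)) :
    Tendsto (fun t : ℝ => Real.exp (-t) * g (Real.exp t)) atTop (𝓝 A) := by
  obtain ⟨M, hM0, hM⟩ := exists_le_mul_of_dilationSum hg hmono h0 hF
  have hexp1 : ∀ t < 0, Real.exp t < 1 := fun t ht => by simpa using Real.exp_lt_exp.mpr ht
  have hgm : Measurable g := hmono.measurable
  have hSm : Measurable (dilationSum g) := (monotone_dilationSum hg hmono).measurable
  set a : ℝ → ℝ := fun t => Real.exp (-t) * g (Real.exp t) with ha
  have ham : Measurable a := by fun_prop
  have ha0 : ∀ t, 0 ≤ a t := fun t => mul_nonneg (Real.exp_pos _).le (h0 _)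
  have haneg : ∀ t < 0, a t = 0 := fun t ht => by simp [ha, hg _ (hexp1 t ht)]
  have haM : ∀ t, a t ≤ M := by
    intro t
    rcases lt_or_ge t 0 with ht | ht
    · rw [haneg t ht]; exact hM0
    · have := hM _ (Real.one_le_exp ht)
      simp only [ha]
      rwa [Real.exp_neg, inv_mul_le_iff₀ (Real.exp_pos _), mul_comm]
  set p : ℝ → ℝ := fun t => Real.exp (-t) * dilationSum g (Real.exp t) with hp
  have hpm : Measurable p := by fun_prop
  have hpneg : ∀ t < 0, p t = 0 := fun t ht => by
    simp [hp, dilationSum_of_lt (hexp1 t ht)]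
  set e : ℝ → ℝ := fun t => p t + (-1) * linearRamp B A t with he
  have hem : Measurable e := hpm.add ((measurable_linearRamp B A).const_mul _)
  have heneg : ∀ t < 0, e t = 0 := fun t ht => by
    simp [he, hpneg t ht, linearRamp_of_lt _ _ ht]
  have helim : Tendsto e atTop (𝓝 0) := by
    refine (hF.tendsto_div_nhds_zero.comp Real.tendsto_exp_atTop).congr' ?_
    filter_upwards [eventually_ge_atTop 0] with t ht
    simp only [Function.comp, he, hp, linearRamp_of_le _ _ ht, Real.log_exp, Real.exp_neg]
    have := (Real.exp_pos t).ne'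
    field_simp
    ring
  obtain ⟨M', hM'⟩ := exists_abs_le_of_tendsto heneg (fun T => by
    refine ⟨dilationSum g (Real.exp T) + (|B| + |A|) * (1 + T), fun t ht hT => ?_⟩
    refine (abs_add_le _ _).trans (add_le_add ?_ ?_)
    · rw [hp, abs_of_nonneg (mul_nonneg (Real.exp_pos _).le (dilationSum_nonneg h0 _))]
      have h1 := monotone_dilationSum hg hmono (Real.exp_le_exp.mpr hT)
      have h2 : Real.exp (-t) ≤ 1 := by simpa using ht
      exact (mul_le_of_le_one_left (dilationSum_nonneg h0 _) h2).trans h1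
    · rw [abs_mul, abs_neg, abs_one, one_mul]
      refine (abs_linearRamp_le B A t).trans ?_
      rw [abs_of_nonneg ht]
      gcongr) helim
  set b : ℝ → ℝ := fun t => a t + (-A) * linearRamp 1 0 t with hb
  have hramp : ∀ t, |linearRamp 1 0 t| ≤ 1 := fun t => by
    unfold linearRamp; split_ifs <;> simp
  have hbm : Measurable b := ham.add ((measurable_linearRamp 1 0).const_mul _)
  have hbneg : ∀ t < 0, b t = 0 := fun t ht => by
    simp [hb, haneg t ht, linearRamp_of_lt _ _ ht]
  have hbM : ∀ t, |b t| ≤ M + |A| := fun t => by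
    refine (abs_add_le _ _).trans (add_le_add ?_ ?_)
    · rw [abs_of_nonneg (ha0 t)]; exact haM t
    · rw [abs_mul, abs_neg]
      exact mul_le_of_le_one_right (abs_nonneg _) (hramp t)
  obtain ⟨R, m, hR, hm, hRm⟩ := exists_analytic_sub_div_eq A B
  have hlap : ∀ s : ℂ, 0 < s.re → laplace b s = R s + m s * laplace e s := by
    intro s hs
    have ia : Integrable fun t : ℝ => (a t : ℂ) * cexp (-(s * t)) :=
      integrable_mul_cexp_neg (M := M) ham haneg (fun t => by
        rw [abs_of_nonneg (ha0 t)]; nlinarith [haM t, abs_nonneg t]) hs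
    have ip : Integrable fun t : ℝ => (p t : ℂ) * cexp (-(s * t)) :=
      integrable_mul_cexp_neg (M := M' + (|B| + |A|)) hpm hpneg (fun t => by
        have h1 : p t = e t + linearRamp B A t := by simp only [he]; ring
        have h2 : 0 ≤ M' := (abs_nonneg _).trans (hM' 0)
        rw [h1]
        refine (abs_add_le _ _).trans ?_
        nlinarith [hM' t, abs_linearRamp_le B A t, abs_nonneg t]) hs
    have l1 : laplace b s = laplace a s - A / s := by
      rw [hb, laplace_add_mul ia (integrable_linearRamp 1 0 hs), laplace_linearRamp 1 0 hs]
      push_cast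
      ring
    have l2 : riemannZeta (1 + s) * laplace a s = B / s + A / s ^ 2 + laplace e s := by
      rw [he, laplace_add_mul ip (integrable_linearRamp B A hs), laplace_linearRamp B A hs,
        ← laplace_dilationSum hg hgm (M := M)
          (fun t => (abs_of_nonneg (ha0 t)).trans_le (haM t)) hs]
      push_cast
      ring
    rw [l1, hRm s _ _ hs l2]
  obtain ⟨k, K, hk, hks, hkK, hK0, hKi, hKpos⟩ := exists_nonneg_bandLimited_kernel
  refine tendsto_of_tendsto_smoothings ham ha0 haM (fun t d hd => ?_) hK0 hKi hKpos
    fun r hr => ?_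
  · simp only [ha]
    rw [← mul_assoc, ← Real.exp_add, neg_add_rev]
    exact mul_le_mul_of_nonneg_left (hmono (Real.exp_le_exp.mpr (by linarith)))
      (Real.exp_pos _).le
  · have t1 := tendsto_integral_comp_sub_mul_kernel hbm hbneg hbM hem heneg hM' helim hR hm hlap
      hk hks hkK hr
    have hlim1 : Tendsto (linearRamp 1 0) atTop (𝓝 1) := by
      refine tendsto_const_nhds.congr' ?_
      filter_upwards [eventually_ge_atTop 0] with t ht
      rw [linearRamp_of_le _ _ ht]; ring
    have t2 := (tendsto_integral_comp_sub_mul (r := r) (measurable_linearRamp 1 0) hramp hlim1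
      hKi).const_mul A
    have t3 := t1.add t2
    rw [zero_add, one_mul] at t3
    refine t3.congr fun x => ?_
    have i1 : Integrable fun y => b (x - r * y) * K y :=
      hKi.bdd_mul (c := M + |A|) (Measurable.aestronglyMeasurable (by fun_prop))
        (ae_of_all _ fun y => hbM _)
    have i2 : Integrable fun y => linearRamp 1 0 (x - r * y) * K y :=
      hKi.bdd_mul (c := 1) ((measurable_linearRamp 1 0).comp (by fun_prop)).aestronglyMeasurable
        (ae_of_all _ fun y => hramp _)
    rw [← integral_const_mul, ← integral_add i1 (i2.const_mul A)]
    congr 1 with y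
    simp only [hb]
    ring

theorem mainTheorem1 (f : ℝ → ℝ) (A B C : ℝ)
    (hf_nonneg : ∀ x ∈ Set.Ici (1 : ℝ), 0 ≤ f x)
    (hf_mono : MonotoneOn f (Set.Ici (1 : ℝ)))
    (hF : (fun x : ℝ => dilationSum f x -
        (A * x * Real.log x + B * x + C * (x / Real.log x)))
      =o[atTop] (fun x : ℝ => x / Real.log x)) :
    ((fun x : ℝ => f x - A * x) =o[atTop] (fun x : ℝ => x)) ∧
      (A ≠ 0 → f ~[atTop] (fun x : ℝ => A * x)) := by
  have hlog : (fun x : ℝ => x / Real.log x) =o[atTop] (fun x : ℝ => x) := by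
    refine (isLittleO_iff_tendsto' ?_).mpr ?_
    · filter_upwards [eventually_gt_atTop 0] with x hx h
      exact absurd h hx.ne'
    · refine (tendsto_inv_atTop_zero.comp Real.tendsto_log_atTop).congr' ?_
      filter_upwards [eventually_gt_atTop 0] with x hx
      simp only [Function.comp]
      field_simp
  -- Only the error term `o(x)` is needed, so the term `C x / log x` is absorbed into it.
  have hG : (fun x : ℝ => dilationSum (extendByZero f) x - (A * x * Real.log x + B * x))
      =o[atTop] (fun x : ℝ => x) := by
    refine ((hF.trans hlog).add (hlog.const_mul_left C)).congr_left fun x => ?_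
    rw [dilationSum_extendByZero]
    ring
  have hlim := tendsto_exp_neg_mul_of_dilationSum (fun x hx => extendByZero_of_lt hx)
    (monotone_extendByZero hf_nonneg hf_mono) (extendByZero_nonneg hf_nonneg) hG
  have hmain : (fun x : ℝ => f x - A * x) =o[atTop] (fun x : ℝ => x) := by
    refine (isLittleO_iff_tendsto' ?_).mpr ?_
    · filter_upwards [eventually_gt_atTop 0] with x hx h
      exact absurd h hx.ne'
    · have h1 := (hlim.comp Real.tendsto_log_atTop).sub_const A
      rw [sub_self] at h1
      refine h1.congr' ?_
      filter_upwards [eventually_ge_atTop 1] with x hx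
      have hx0 : 0 < x := by linarith
      simp only [Function.comp]
      rw [Real.exp_neg, Real.exp_log hx0, extendByZero_of_le hx]
      field_simp
  exact ⟨hmain, fun hA => hmain.trans_isBigO (isBigO_self_const_mul hA _ _)⟩
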